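/- **Theorem (Agreement of Mahi-Mahi with wave length 4).** Let $f\ge 0$, $n=3f+1$ and $1\le \ell\le n$. Consider the Mahi-Mahi protocol with $n$ validators, wave length $4$ and $\ell$ leader slots per round, as described below, in the asynchronous or in the random network model. Then, with probability $1$: every block that is delivered by some honest validator is eventually delivered by every honest validator. *Blocks.* A block consists of an author, a round number $\ge 1$, a list of transactions and an ordered list of references to blocks (hashes are collision free, so a reference determines the block); it is signed and carries its author's share of the coin that its round reveals. A block of round $R$ is valid if its references are distinct valid blocks of rounds $<R$ and, when $R>1$, include blocks of round $R-1$ by at least $2f+1$ distinct validators. The causal history of a block is the set of all blocks reachable from it by references, including itself. *System.* An adversary adaptively corrupts at most $f$ validators, which may then deviate arbitrarily, but cannot forge signatures; validators that are never corrupted are *honest*. Validators exchange point-to-point messages, scheduled by the adversary; every message between honest validators is eventually received. The local DAG of a validator is the set of valid blocks whose entire causal history it has created or received. On receiving a block from some validator, an uncorrupted validator requests from the sender the references of that block missing in its local DAG, and it answers requests for blocks that it has. An uncorrupted validator creates and broadcasts exactly one block per round, in the order of rounds: once its local DAG contains blocks of its current round by $2f+1$ validators (or at the start, for round $1$), it eventually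 creates a valid block for the next round, which references only blocks of its local DAG and whose causal history contains all blocks of earlier rounds in its local DAG. *Coin.* The common coin assigns to each round $r$ an ordered list of $\ell$ distinct validators, the leaders of the slots $(r,0),\dots,(r,\ell-1)$; it can be reconstructed from shares of $2f+1$ validators contained in blocks of round $r+3$. It is perfect: as long as fewer than $2f+1$ validators are corrupted or have created a round-$(r+3)$ block, each slot of round $r$ has, conditionally on the history of the execution (including the action that the adversary schedules next), a uniformly distributed leader. *Network models.* In the asynchronous model the adversary, knowing the whole history, schedules everything subject to the rules above. The random network model is the variant in which the round-$r$ blocks referenced by the round-$(r+1)$ block of an uncorrupted validator $v$ are, besides its own, those of a random set $Q_{v,r}$ of $2f+1$ validators; given the DAG up to round $r$, the sets $Q_{v,r}$ are independent and uniform among the sets of $2f+1$ validators that have valid round-$r$ blocks. *Decision rule.* A round-$(r+2)$ block *votes* for a round-$r$ block $b$ if $b$ is the first block with the author and round of $b$ met by a depth-first search along the ordered references. A *certificate* for $b$ is a round-$(r+3)$ block that references votes for $b$ of round $r+2$ by at least $2f+1$ distinct validators. Slots are ordered by round and then by index; the blocks in a slot are those of its round by its leader. A validator leaves a slot $s$ of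 round $r$ undecided until its local DAG contains round-$(r+3)$ blocks of $2f+1$ validators. It then commits a block $b$ of $s$ directly if its local DAG contains certificates for $b$ by $2f+1$ validators; it skips $s$ directly if its local DAG contains round-$(r+2)$ blocks by $2f+1$ validators and, for each block $b$ of $s$ in its local DAG, round-$(r+2)$ blocks by $2f+1$ validators that do not vote for $b$. If neither applies, let the anchor be the first slot of round $>r+3$ that is not skipped. If the anchor is committed with block $a$, then the validator commits in $s$ a block of $s$ that has a certificate in the causal history of $a$, and skips $s$ if there is none; otherwise $s$ is undecided. *Delivery.* A block $b$ is delivered by a validator at slot $s$ if, in its local DAG at some time, $s$ is committed with some leader block $l$, $b$ is in the causal history of $l$, all earlier slots are decided (committed or skipped), and $b$ is not in the causal history of the leader block of any earlier committed slot. -/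

import Mathlib

open MeasureTheory Set
open scoped ENNReal

namespace MahiMahi

/-! ## Validators, blocks and the block DAG -/

/-- The committee: `n = 3 f + 1` validators. -/
abbrev Validator (f : ℕ) : Type := Fin (3 * f + 1)

/-- A set of at least `2 f + 1` distinct validators. -/
def Quorum {f : ℕ} (S : Set (Validator f)) : Prop := 2 * f + 1 ≤ S.ncard

/-- Blocks: author, round number, transactions, and the ordered list of referenced blocks.
Hash references are ideal (collision free), so that a reference is identified with the block it
points to. The signature of the author is accounted for by the transition system below (a block of
an uncorrupted validator circulates only if that validator created it), and so is the author's share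
of the common coin of the wave that the round certifies, which every block carries. -/
inductive Block (f : ℕ) (Tx : Type*) where
  | mk (author : Validator f) (round : ℕ) (txs : List Tx) (parents : List (Block f Tx))

namespace Block

variable {f : ℕ} {Tx : Type*}

def author : Block f Tx → Validator f
  | mk a _ _ _ => a

def round : Block f Tx → ℕ
  | mk _ r _ _ => r

def parents : Block f Tx → List (Block f Tx)
  | mk _ _ _ ps => ps

/-- There is a (possibly empty) path of references from `new` to `old`; equivalently, `old` lies in
the causal history of `new` (which contains `new` itself). -/
def IsLink (old new : Block f Tx) : Prop :=
  Relation.ReflTransGen (fun p b : Block f Tx => p ∈ b.parents) old new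

/-- Valid blocks. Rounds are numbered from `1`; a block references distinct valid blocks of earlier
rounds, and, after the first round, blocks of at least `2 f + 1` distinct validators from the
immediately preceding round. -/
inductive Valid : Block f Tx → Prop where
  | intro (b : Block f Tx)
      (round_pos : 1 ≤ b.round)
      (parents_valid : ∀ p ∈ b.parents, Valid p)
      (parents_earlier : ∀ p ∈ b.parents, p.round < b.round)
      (parents_distinct : b.parents.Nodup)
      (parents_quorum : b.round = 1 ∨
        Quorum {v | ∃ p ∈ b.parents, p.author = v ∧ p.round + 1 = b.round}) :
      Valid b

mutual

/-- The first block of author `id` and round `r` met by the depth-first search that starts at the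
given block and follows the references in order. -/
def votedBlock (id : Validator f) (r : ℕ) : Block f Tx → Option (Block f Tx)
  | mk _ ρ _ ps => if ρ ≤ r then none else votedBlockList id r ps

/-- The depth-first search through a list of references. -/
def votedBlockList (id : Validator f) (r : ℕ) : List (Block f Tx) → Option (Block f Tx)
  | [] => none
  | b :: bs =>
      if b.author = id ∧ b.round = r then some b
      else match votedBlock id r b with
        | some x => some x
        | none => votedBlockList id r bs

end

end Block

/-! ## Waves and the decision rule -/

/-- The number of rounds of a wave: propose, boost, vote, certify. -/
def waveLength : ℕ := 4

/-- The certify round of the wave whose propose round is `r`. -/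
def certifyRound (r : ℕ) : ℕ := r + (waveLength - 1)

/-- The vote round of the wave whose propose round is `r`. -/
def voteRound (r : ℕ) : ℕ := r + (waveLength - 2)

section Rules

variable {f ℓ : ℕ} {Tx : Type*}

/-- `x` is a vote for `b`. -/
def IsVote (x b : Block f Tx) : Prop := Block.votedBlock b.author b.round x = some b

/-- `c` is a certificate for `b`: it references votes for `b`, from the vote round of `b`, by at least
`2 f + 1` distinct validators. -/
def IsCert (c b : Block f Tx) : Prop :=
  c.round = certifyRound b.round ∧
    Quorum {v | ∃ x ∈ c.parents, x.author = v ∧ x.round = voteRound b.round ∧ IsVote x b}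

/-- The leader slot number `idx` of round `round`. -/
structure Slot (ℓ : ℕ) where
  round : ℕ
  idx : Fin ℓ

/-- The order in which slots are committed: by round, then by index. -/
def Slot.Before (s s' : Slot ℓ) : Prop :=
  s.round < s'.round ∨ s.round = s'.round ∧ s.idx < s'.idx

/-- The outcomes of the common coin: for every round, its `ℓ` distinct leaders, in order. -/
abbrev Leaders (f ℓ : ℕ) : Type := ℕ → (Fin ℓ ↪ Validator f)

/-- The view `D` contains the coin shares of `2 f + 1` validators in the certify round of `r`, from
which the leaders of round `r` are reconstructed. -/
def CoinKnown (D : Set (Block f Tx)) (r : ℕ) : Prop :=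
  Quorum {v | ∃ c ∈ D, c.author = v ∧ c.round = certifyRound r}

/-- The blocks of the view `D` in slot `s`: none, one, or several equivocating ones. -/
def slotBlocks (D : Set (Block f Tx)) (L : Leaders f ℓ) (s : Slot ℓ) : Set (Block f Tx) :=
  {b ∈ D | b.author = L s.round s.idx ∧ b.round = s.round}

/-- Direct commit: `b` is in the slot and certificates by `2 f + 1` distinct validators are seen. -/
def DirectCommit (D : Set (Block f Tx)) (L : Leaders f ℓ) (s : Slot ℓ) (b : Block f Tx) : Prop :=
  CoinKnown D s.round ∧ b ∈ slotBlocks D L s ∧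
    Quorum {v | ∃ c ∈ D, c.author = v ∧ IsCert c b}

/-- Direct skip: blocks of the vote round by `2 f + 1` distinct validators are seen, and every block
of the slot is skipped, in that blocks of the vote round by `2 f + 1` distinct validators do not vote
for it. (An empty slot is thus skipped once `2 f + 1` validators are seen in the vote round.) -/
def DirectSkip (D : Set (Block f Tx)) (L : Leaders f ℓ) (s : Slot ℓ) : Prop :=
  CoinKnown D s.round ∧
    Quorum {v | ∃ x ∈ D, x.author = v ∧ x.round = voteRound s.round} ∧
    ∀ b ∈ slotBlocks D L s,
      Quorum {v | ∃ x ∈ D, x.author = v ∧ x.round = voteRound s.round ∧ ¬ IsVote x b}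

/-- The direct decision rule classifies the slot. -/
def DirectlyDecided (D : Set (Block f Tx)) (L : Leaders f ℓ) (s : Slot ℓ) : Prop :=
  DirectSkip D L s ∨ ∃ b, DirectCommit D L s b

/-- A certificate for `b` lies in the causal history of `a`. -/
def IsCertifiedLink (D : Set (Block f Tx)) (a b : Block f Tx) : Prop :=
  ∃ c ∈ D, IsCert c b ∧ Block.IsLink c a

/-- The classification of a decided slot. -/
inductive Decision (f : ℕ) (Tx : Type*) where
  | commit (b : Block f Tx)
  | skip

/-- `Decides D L s d`: a validator whose local DAG is `D` classifies slot `s` as `d`; a slot with no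
such `d` is undecided. In the indirect rule `s'` is the anchor of `s`: the first slot past the
certify round of `s` that is not classified as skip; it has to be committed. -/
inductive Decides (D : Set (Block f Tx)) (L : Leaders f ℓ) : Slot ℓ → Decision f Tx → Prop where
  | directCommit (s : Slot ℓ) (b : Block f Tx) (h : DirectCommit D L s b) :
      Decides D L s (.commit b)
  | directSkip (s : Slot ℓ) (h : DirectSkip D L s) :
      Decides D L s .skip
  | indirectCommit (s s' : Slot ℓ) (a b : Block f Tx)
      (coin : CoinKnown D s.round)
      (undecided : ¬ DirectlyDecided D L s)
      (later : certifyRound s.round < s'.round)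
      (first : ∀ u : Slot ℓ, certifyRound s.round < u.round → u.Before s' → Decides D L u .skip)
      (anchor : Decides D L s' (.commit a))
      (mem : b ∈ slotBlocks D L s)
      (link : IsCertifiedLink D a b) :
      Decides D L s (.commit b)
  | indirectSkip (s s' : Slot ℓ) (a : Block f Tx)
      (coin : CoinKnown D s.round)
      (undecided : ¬ DirectlyDecided D L s)
      (later : certifyRound s.round < s'.round)
      (first : ∀ u : Slot ℓ, certifyRound s.round < u.round → u.Before s' → Decides D L u .skip)
      (anchor : Decides D L s' (.commit a))
      (no_link : ∀ b ∈ slotBlocks D L s, ¬ IsCertifiedLink D a b) :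
      Decides D L s .skip

/-- In the local DAG `D`, block `b` is delivered at slot `s` with leader block `l`: slot `s` is
committed with `l`, `b` is in the causal history of `l`, all earlier slots are decided, and `b` is
not in the causal history of the leader block of an earlier slot. -/
def DeliveredAt (D : Set (Block f Tx)) (L : Leaders f ℓ) (s : Slot ℓ) (l b : Block f Tx) : Prop :=
  Decides D L s (.commit l) ∧ b.IsLink l ∧
    (∀ s' : Slot ℓ, 1 ≤ s'.round → s'.Before s → ∃ d, Decides D L s' d) ∧
    (∀ s' : Slot ℓ, s'.Before s → ∀ l', Decides D L s' (.commit l') → ¬ b.IsLink l')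

/-- In the local DAG `D`, block `b` is delivered. -/
def Delivered (D : Set (Block f Tx)) (L : Leaders f ℓ) (b : Block f Tx) : Prop :=
  ∃ s l, DeliveredAt D L s l b

end Rules

/-! ## The message-passing system -/

section System

variable {f ℓ : ℕ} {Tx : Type*}

/-- Message contents: a block, or a request for a missing block. -/
inductive Content (f : ℕ) (Tx : Type*) where
  | block (b : Block f Tx)
  | request (b : Block f Tx)

/-- A point-to-point message. -/
structure Message (f : ℕ) (Tx : Type*) where
  src : Validator f
  dst : Validator f
  content : Content f Tx

/-- A global configuration. -/
structure Config (f : ℕ) (Tx : Type*) where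
  /-- the validators corrupted so far -/
  corrupted : Finset (Validator f)
  /-- the blocks created so far by validators that were not corrupted at that time -/
  signed : Set (Block f Tx)
  /-- the round of the latest block created by each validator (`0` if there is none) -/
  round : Validator f → ℕ
  /-- the blocks that each validator has created or received -/
  store : Validator f → Set (Block f Tx)
  /-- the messages sent so far -/
  sent : Set (Message f Tx)

def Config.initial : Config f Tx where
  corrupted := ∅
  signed := ∅
  round := fun _ => 0
  store := fun _ => ∅
  sent := ∅

/-- The local DAG of `v`: the valid blocks whose entire causal history `v` has downloaded. -/
def Config.dag (c : Config f Tx) (v : Validator f) : Set (Block f Tx) :=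
  {b | b.Valid ∧ ∀ a : Block f Tx, a.IsLink b → a ∈ c.store v}

/-- Atomic actions of the system. -/
inductive Action (f : ℕ) (Tx : Type*) where
  /-- an uncorrupted validator creates a block and broadcasts it -/
  | propose (v : Validator f) (b : Block f Tx)
  /-- the network hands a message to its destination -/
  | receive (m : Message f Tx)
  /-- the adversary sends a message on behalf of a corrupted validator -/
  | inject (m : Message f Tx)
  /-- the adversary corrupts a validator -/
  | corrupt (v : Validator f)

/-- When an action may take place. An uncorrupted validator creates one block per round, in the order
of rounds; the block is valid, references only blocks of the local DAG, and refers (directly or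
through its references) to all blocks of earlier rounds in the local DAG. The adversary corrupts at
most `f` validators and cannot forge signatures. -/
def Enabled (c : Config f Tx) : Action f Tx → Prop
  | .propose v b => v ∉ c.corrupted ∧ b.author = v ∧ b.round = c.round v + 1 ∧ b.Valid ∧
      (∀ p ∈ b.parents, p ∈ c.dag v) ∧ (∀ x ∈ c.dag v, x.round < b.round → x.IsLink b)
  | .receive m => m ∈ c.sent
  | .inject m => m.src ∈ c.corrupted ∧
      ∀ b, m.content = .block b → b.author ∈ c.corrupted ∨ b ∈ c.signed
  | .corrupt v => (insert v c.corrupted).card ≤ f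

/-- The messages sent in an action. A block is broadcast when it is created. An uncorrupted validator
that receives a block requests, from the sender, the referenced blocks that are not yet in its local
DAG; if it receives a request for a block it has, it answers with the block. -/
def emits (c : Config f Tx) : Action f Tx → Set (Message f Tx)
  | .propose v b => {m | m.src = v ∧ m.content = .block b}
  | .receive m => {m' | m.dst ∉ c.corrupted ∧ m'.src = m.dst ∧ m'.dst = m.src ∧
      ((∃ b p, m.content = .block b ∧ p ∈ b.parents ∧ p ∉ c.dag m.dst ∧ m'.content = .request p) ∨
        ∃ b, m.content = .request b ∧ b ∈ c.store m.dst ∧ m'.content = .block b)}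
  | .inject m => {m}
  | .corrupt _ => ∅

/-- The configuration after an action. -/
def next (c : Config f Tx) (a : Action f Tx) : Config f Tx where
  corrupted := match a with
    | .corrupt v => insert v c.corrupted
    | _ => c.corrupted
  signed := match a with
    | .propose _ b => insert b c.signed
    | _ => c.signed
  round := match a with
    | .propose v b => Function.update c.round v b.round
    | _ => c.round
  store := match a with
    | .propose v b => fun u => {x | x ∈ c.store u ∨ u = v ∧ x = b}
    | .receive m => fun u => {x | x ∈ c.store u ∨
        u = m.dst ∧ m.dst ∉ c.corrupted ∧ m.content = .block x}
    | _ => c.store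
  sent := c.sent ∪ emits c a

/-- The configuration before the `t`-th action. -/
def configAt (a : ℕ → Action f Tx) : ℕ → Config f Tx
  | 0 => Config.initial
  | t + 1 => next (configAt a t) (a t)

/-- The validator is never corrupted. -/
def Honest (a : ℕ → Action f Tx) (v : Validator f) : Prop :=
  ∀ t, v ∉ (configAt a t).corrupted

/-- The validator may create the block of its next round: it is in the first round, or its local DAG
has blocks of its current round by `2 f + 1` distinct validators. -/
def Ready (c : Config f Tx) (v : Validator f) : Prop :=
  c.round v = 0 ∨ Quorum {u | ∃ x ∈ c.dag v, x.author = u ∧ x.round = c.round v}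

/-- The runs of the protocol: all actions are enabled; a message between honest validators is
eventually received, with no bound on the delay; an honest validator that may create the block of its
next round eventually does so. -/
structure IsRun (a : ℕ → Action f Tx) : Prop where
  enabled : ∀ t, Enabled (configAt a t) (a t)
  reliable : ∀ t, ∀ m ∈ emits (configAt a t) (a t), Honest a m.src → Honest a m.dst →
    ∃ t' > t, a t' = .receive m
  progress : ∀ v, Honest a v → ∀ t, Ready (configAt a t) v → ∃ t' ≥ t, ∃ b, a t' = .propose v b

/-- The adversary can reconstruct the coin of round `r`: `2 f + 1` validators are corrupted or have
released their share, in a block of the certify round of `r`. -/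
def CoinRevealed (c : Config f Tx) (r : ℕ) : Prop :=
  Quorum {v | v ∈ c.corrupted ∨ ∃ b ∈ c.signed, b.author = v ∧ b.round = certifyRound r}

/-- The valid blocks of a run: those in the local DAG, at some time, of a then uncorrupted validator. -/
def existingBlocks (a : ℕ → Action f Tx) : Set (Block f Tx) :=
  {b | ∃ t v, v ∉ (configAt a t).corrupted ∧ b ∈ (configAt a t).dag v}

/-- The validators with a valid block of round `r`. -/
def available (a : ℕ → Action f Tx) (r : ℕ) : Set (Validator f) :=
  {v | ∃ b ∈ existingBlocks a, b.author = v ∧ b.round = r}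

end System

/-! ## Random executions and network models -/

section Models

variable {f ℓ : ℕ} {Tx : Type*} {Ω : Type*}

/-- A random execution: a random sequence of actions and random coin outcomes. -/
structure Execution (f ℓ : ℕ) (Tx : Type*) (Ω : Type*) where
  action : ℕ → Ω → Action f Tx
  coin : ℕ → Ω → (Fin ℓ ↪ Validator f)

/-- The sequence of actions of the sample point `ω`. -/
def Execution.trace (X : Execution f ℓ Tx Ω) (ω : Ω) : ℕ → Action f Tx :=
  fun t => X.action t ω

/-- The coin outcomes of the sample point `ω`. -/
def Execution.leaders (X : Execution f ℓ Tx Ω) (ω : Ω) : Leaders f ℓ :=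
  fun r => X.coin r ω

variable [MeasurableSpace Ω]

/-- The coin is perfect: there is a filtration, the history available to the adversary when it
schedules the next action (together with that action), such that, as long as the coin of round `r`
is not revealed, each leader slot of round `r` belongs to a uniformly random validator, whatever the
history. -/
def Execution.PerfectCoin (X : Execution f ℓ Tx Ω) (μ : Measure Ω) : Prop :=
  (∀ r e, MeasurableSet {ω | X.coin r ω = e}) ∧
  ∃ ℱ : Filtration ℕ (inferInstance : MeasurableSpace Ω),
    (∀ t a, MeasurableSet[ℱ t] {ω | X.action t ω = a}) ∧
    ∀ (r t : ℕ) (E : Set Ω), MeasurableSet[ℱ t] E →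
      (∀ ω ∈ E, ¬ CoinRevealed (configAt (X.trace ω) t) r) →
      ∀ (k : Fin ℓ) (v : Validator f),
        μ (E ∩ {ω | X.coin r ω k = v}) = μ E / ((3 * f + 1 : ℕ) : ℝ≥0∞)

/-- The asynchronous network model: an adversary that knows the whole history schedules all actions,
subject to the rules for runs; the coin is perfect. -/
structure Execution.IsAsynchronous (X : Execution f ℓ Tx Ω) (μ : Measure Ω) : Prop where
  run : ∀ᵐ ω ∂μ, IsRun (X.trace ω)
  perfectCoin : X.PerfectCoin μ

/-- The events that depend only on which valid blocks of rounds up to `r` exist. -/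
abbrev Execution.dagUpTo (X : Execution f ℓ Tx Ω) (r : ℕ) : MeasurableSpace Ω :=
  MeasurableSpace.generateFrom
    {A | ∃ b : Block f Tx, b.round ≤ r ∧ A = {ω | b ∈ existingBlocks (X.trace ω)}}

/-- The random network model: the variant of the asynchronous one in which the round-`r` blocks that
an uncorrupted validator `v` receives and references in its block of round `r + 1` (besides its own)
are those of a random set `Q v r` of `2 f + 1` validators; given the DAG up to round `r`, the sets
`Q v r` are independent and uniform among the sets of `2 f + 1` validators with a valid block of
round `r`. -/
structure Execution.IsRandomNetwork (X : Execution f ℓ Tx Ω) (μ : Measure Ω) : Prop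
    extends X.IsAsynchronous μ where
  sampling : ∃ Q : Validator f → ℕ → Ω → Finset (Validator f),
    (∀ᵐ ω ∂μ, ∀ t v b, X.action t ω = .propose v b → ∀ r, 1 ≤ r → b.round = r + 1 →
      {u | ∃ p ∈ b.parents, p.author = u ∧ p.round = r} = insert v (Q v r ω : Set (Validator f))) ∧
    ∀ (r : ℕ), 1 ≤ r → ∀ (E : Set Ω), MeasurableSet[X.dagUpTo r] E →
      ∀ (S : Finset (Validator f)) (T : Validator f → Finset (Validator f)),
        (∀ v, T v ⊆ S ∧ (T v).card = 2 * f + 1) →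
        μ (E ∩ {ω | available (X.trace ω) r = S} ∩ {ω | ∀ v, Q v r ω = T v}) =
          μ (E ∩ {ω | available (X.trace ω) r = S}) /
            ((S.card.choose (2 * f + 1) ^ (3 * f + 1) : ℕ) : ℝ≥0∞)

/-- Agreement: with probability 1, every block delivered by an honest validator is eventually
delivered by every honest validator. -/
def Execution.Agreement (X : Execution f ℓ Tx Ω) (μ : Measure Ω) : Prop :=
  ∀ᵐ ω ∂μ, ∀ i j, Honest (X.trace ω) i → Honest (X.trace ω) j → ∀ b : Block f Tx,
    (∃ t, Delivered ((configAt (X.trace ω) t).dag i) (X.leaders ω) b) →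
    ∃ t, Delivered ((configAt (X.trace ω) t).dag j) (X.leaders ω) b

end Models

end MahiMahi

namespace MahiMahi

/-! ## Quorums -/

theorem Quorum.mono {f : ℕ} {A B : Set (Validator f)} (h : Quorum A) (hAB : A ⊆ B) : Quorum B :=
  le_trans h (Set.ncard_le_ncard hAB (Set.toFinite B))

theorem Quorum.nonempty {f : ℕ} {A : Set (Validator f)} (h : Quorum A) : A.Nonempty := by
  apply Set.nonempty_of_ncard_ne_zero
  unfold Quorum at h
  omega

/-- Any three quorums have a common member. -/
theorem Quorum.exists_mem {f : ℕ} {A B C : Set (Validator f)} (hA : Quorum A) (hB : Quorum B)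
    (hC : Quorum C) : ∃ v, v ∈ A ∧ v ∈ B ∧ v ∈ C := by
  unfold Quorum at hA hB hC
  have h₁ := Set.ncard_union_add_ncard_inter A B
  have h₂ := Set.ncard_union_add_ncard_inter (A ∩ B) C
  have card_le : ∀ S : Set (Validator f), S.ncard ≤ 3 * f + 1 := fun S => by
    simpa using Set.ncard_le_card S
  have h₃ := card_le (A ∪ B)
  have h₄ := card_le (A ∩ B ∪ C)
  obtain ⟨v, ⟨hvA, hvB⟩, hvC⟩ : (A ∩ B ∩ C).Nonempty := by
    apply Set.nonempty_of_ncard_ne_zero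
    omega
  exact ⟨v, hvA, hvB, hvC⟩

/-! ## The block DAG -/

namespace Block

variable {f : ℕ} {Tx : Type*}

theorem IsLink.trans {a b c : Block f Tx} (h : a.IsLink b) (h' : b.IsLink c) : a.IsLink c :=
  Relation.ReflTransGen.trans h h'

theorem IsLink.of_mem_parents {p b : Block f Tx} (h : p ∈ b.parents) : p.IsLink b :=
  Relation.ReflTransGen.single h

theorem IsLink.eq_or_exists_parent {a b : Block f Tx} (h : a.IsLink b) :
    a = b ∨ ∃ p ∈ b.parents, a.IsLink p := by
  rcases Relation.ReflTransGen.cases_tail h with h | ⟨p, h, hp⟩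
  · exact .inl h.symm
  · exact .inr ⟨p, hp, h⟩

theorem Valid.parent {p b : Block f Tx} (h : b.Valid) (hp : p ∈ b.parents) : p.Valid := by
  cases h with
  | intro _ _ hv => exact hv p hp

theorem Valid.one_le_round {b : Block f Tx} (h : b.Valid) : 1 ≤ b.round := by
  cases h with
  | intro _ h => exact h

theorem Valid.of_isLink {a b : Block f Tx} (h : b.Valid) (hab : a.IsLink b) : a.Valid := by
  induction hab using Relation.ReflTransGen.head_induction_on with
  | refl => exact h
  | head hp _ ih => exact ih.parent hp

/-- The causal history of a valid block has a quorum of authors in every earlier round. -/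
theorem Valid.quorum_history {a : Block f Tx} (h : a.Valid) {ρ : ℕ} (hρ : 1 ≤ ρ)
    (hlt : ρ < a.round) :
    Quorum {v | ∃ c : Block f Tx, c.IsLink a ∧ c.author = v ∧ c.round = ρ} := by
  induction h with
  | intro b _ _ _ _ hq ih =>
    have hq := hq.resolve_left (by omega)
    rcases Nat.lt_or_ge ρ (b.round - 1) with hlt' | hge
    · obtain ⟨v, p, hp, -, hr⟩ := hq.nonempty
      refine (ih p hp (by omega)).mono ?_
      rintro w ⟨c, hc, hw⟩
      exact ⟨c, hc.trans (.of_mem_parents hp), hw⟩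
    · refine hq.mono ?_
      rintro w ⟨p, hp, hw, hr⟩
      exact ⟨p, .of_mem_parents hp, hw, by omega⟩

mutual

theorem votedBlock_spec (id : Validator f) (r : ℕ) (b : Block f Tx) :
    ∀ x : Block f Tx, votedBlock id r x = some b → b.author = id ∧ b.round = r ∧ b.IsLink x
  | mk a ρ txs ps, h => by
    rw [votedBlock] at h
    split at h
    · cases h
    · obtain ⟨h₁, h₂, p, hp, h₃⟩ := votedBlockList_spec id r b ps h
      exact ⟨h₁, h₂, h₃.trans (.of_mem_parents hp)⟩

theorem votedBlockList_spec (id : Validator f) (r : ℕ) (b : Block f Tx) :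
    ∀ xs : List (Block f Tx), votedBlockList id r xs = some b →
      b.author = id ∧ b.round = r ∧ ∃ p ∈ xs, b.IsLink p
  | [], h => by simp [votedBlockList] at h
  | x :: xs, h => by
    rw [votedBlockList] at h
    split at h
    · next hx =>
      cases h
      exact ⟨hx.1, hx.2, _, List.mem_cons_self, .refl⟩
    · split at h
      · next y hy =>
        cases h
        obtain ⟨h₁, h₂, h₃⟩ := votedBlock_spec id r b x hy
        exact ⟨h₁, h₂, x, List.mem_cons_self, h₃⟩
      · obtain ⟨h₁, h₂, p, hp, h₃⟩ := votedBlockList_spec id r b xs h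
        exact ⟨h₁, h₂, p, List.mem_cons_of_mem _ hp, h₃⟩

end

end Block

theorem IsVote.isLink {f : ℕ} {Tx : Type*} {x b : Block f Tx} (h : IsVote x b) : b.IsLink x :=
  (Block.votedBlock_spec _ _ _ _ h).2.2

/-- A block votes for at most one block of each author and round. -/
theorem IsVote.unique {f : ℕ} {Tx : Type*} {x b b' : Block f Tx} (h : IsVote x b)
    (h' : IsVote x b') (ha : b.author = b'.author) (hr : b.round = b'.round) : b = b' := by
  unfold IsVote at h h'
  rw [ha, hr, h'] at h
  exact (Option.some.inj h).symm

theorem IsCert.isLink {f : ℕ} {Tx : Type*} {c b : Block f Tx} (h : IsCert c b) : b.IsLink c := by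
  obtain ⟨_, x, hx, -, -, hv⟩ := h.2.nonempty
  exact hv.isLink.trans (.of_mem_parents hx)

/-! ## Consistency and monotonicity of the decision rule -/

section Decisions

variable {f ℓ : ℕ} {Tx : Type*}

/-- `U` is a causally closed set of valid blocks in which the validators of some quorum `H` do not
equivocate. -/
structure NonEquivocating (H : Set (Validator f)) (U : Set (Block f Tx)) : Prop where
  quorum : Quorum H
  valid : ∀ b ∈ U, b.Valid
  closed : ∀ b ∈ U, ∀ a : Block f Tx, a.IsLink b → a ∈ U
  unique : ∀ x ∈ U, ∀ y ∈ U, x.author ∈ H → x.author = y.author → x.round = y.round → x = y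

/-- `D` is a causally closed subset of `U`. -/
structure IsView (U D : Set (Block f Tx)) : Prop where
  subset : D ⊆ U
  closed : ∀ b ∈ D, ∀ a : Block f Tx, a.IsLink b → a ∈ D

variable {H : Set (Validator f)} {U D D₁ D₂ : Set (Block f Tx)} {L : Leaders f ℓ}

/-- Two quorums of authors of blocks of the same round in `U` have a block in common. -/
theorem NonEquivocating.exists_common (hU : NonEquivocating H U) {P Q : Block f Tx → Prop} {r : ℕ}
    (hP : Quorum {v | ∃ x ∈ U, x.author = v ∧ x.round = r ∧ P x})
    (hQ : Quorum {v | ∃ x ∈ U, x.author = v ∧ x.round = r ∧ Q x}) :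
    ∃ x ∈ U, x.round = r ∧ P x ∧ Q x := by
  obtain ⟨v, ⟨x, hx, rfl, hxr, hPx⟩, ⟨y, hy, hyx, hyr, hQy⟩, hv⟩ := hP.exists_mem hQ hU.quorum
  obtain rfl := hU.unique x hx y hy hv hyx.symm (hxr.trans hyr.symm)
  exact ⟨x, hx, hxr, hPx, hQy⟩

theorem NonEquivocating.quorum_votes (hU : NonEquivocating H U) {c b : Block f Tx} (hc : c ∈ U)
    (h : IsCert c b) :
    Quorum {v | ∃ x ∈ U, x.author = v ∧ x.round = voteRound b.round ∧ IsVote x b} := by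
  refine h.2.mono ?_
  rintro v ⟨x, hx, hv⟩
  exact ⟨x, hU.closed c hc x (.of_mem_parents hx), hv⟩

theorem NonEquivocating.cert_unique (hU : NonEquivocating H U) {c c' b b' : Block f Tx}
    (hc : c ∈ U) (hc' : c' ∈ U) (h : IsCert c b) (h' : IsCert c' b')
    (ha : b.author = b'.author) (hr : b.round = b'.round) : b = b' := by
  have hQ := hU.quorum_votes hc' h'
  rw [← hr] at hQ
  obtain ⟨x, -, -, hx, hx'⟩ := hU.exists_common (hU.quorum_votes hc h) hQ
  exact hx.unique hx' ha hr

theorem Decides.commit_spec {s : Slot ℓ} {b : Block f Tx} (h : Decides D L s (.commit b)) :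
    b ∈ slotBlocks D L s ∧ ∃ c ∈ D, IsCert c b := by
  cases h with
  | directCommit _ _ h =>
    obtain ⟨_, c, hc, -, hcert⟩ := h.2.2.nonempty
    exact ⟨h.2.1, c, hc, hcert⟩
  | indirectCommit _ _ a _ _ _ _ _ _ mem link =>
    obtain ⟨c, hc, hcert, -⟩ := link
    exact ⟨mem, c, hc, hcert⟩

theorem commit_unique (hU : NonEquivocating H U) (h₁ : IsView U D₁) (h₂ : IsView U D₂)
    {s : Slot ℓ} {b b' : Block f Tx} (hb : Decides D₁ L s (.commit b))
    (hb' : Decides D₂ L s (.commit b')) : b = b' := by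
  obtain ⟨m, c, hc, hcert⟩ := hb.commit_spec
  obtain ⟨m', c', hc', hcert'⟩ := hb'.commit_spec
  exact hU.cert_unique (h₁.subset hc) (h₂.subset hc') hcert hcert'
    (m.2.1.trans m'.2.1.symm) (m.2.2.trans m'.2.2.symm)

theorem not_commit_of_directSkip (hU : NonEquivocating H U) (h₁ : IsView U D₁) (h₂ : IsView U D₂)
    {s : Slot ℓ} {b : Block f Tx} (hs : DirectSkip D₁ L s) (hb : Decides D₂ L s (.commit b)) :
    False := by
  obtain ⟨m, c, hc, hcert⟩ := hb.commit_spec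
  have hvotes := hU.quorum_votes (h₂.subset hc) hcert
  rw [m.2.2] at hvotes
  have hseen : Quorum {v | ∃ x ∈ U, x.author = v ∧ x.round = voteRound s.round ∧ x ∈ D₁} := by
    refine hs.2.1.mono ?_
    rintro v ⟨x, hx, hv⟩
    exact ⟨x, h₁.subset hx, hv.1, hv.2, hx⟩
  obtain ⟨x, -, -, hx, hxD⟩ := hU.exists_common hvotes hseen
  have hbD : b ∈ slotBlocks D₁ L s := ⟨h₁.closed x hxD b hx.isLink, m.2⟩
  have hno : Quorum {v | ∃ x ∈ U, x.author = v ∧ x.round = voteRound s.round ∧ ¬ IsVote x b} := by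
    refine (hs.2.2 b hbD).mono ?_
    rintro v ⟨x, hx, hv⟩
    exact ⟨x, h₁.subset hx, hv⟩
  obtain ⟨y, -, -, hy, hy'⟩ := hU.exists_common hvotes hno
  exact hy' hy

/-- A directly committed block has a certificate in the causal history of every block past the
certify round. -/
theorem DirectCommit.isCertifiedLink (hU : NonEquivocating H U) (h₁ : IsView U D₁)
    (h₂ : IsView U D₂) {s : Slot ℓ} {a b : Block f Tx} (hb : DirectCommit D₁ L s b) (ha : a ∈ D₂)
    (hlt : certifyRound s.round < a.round) : b ∈ slotBlocks D₂ L s ∧ IsCertifiedLink D₂ a b := by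
  have hround : b.round = s.round := hb.2.1.2.2
  have hcerts : Quorum {v | ∃ c ∈ U, c.author = v ∧ c.round = certifyRound s.round ∧
      IsCert c b} := by
    refine hb.2.2.mono ?_
    rintro v ⟨c, hc, hv, hcert⟩
    exact ⟨c, h₁.subset hc, hv, hround ▸ hcert.1, hcert⟩
  have hhist : Quorum {v | ∃ c ∈ U, c.author = v ∧ c.round = certifyRound s.round ∧
      c.IsLink a} := by
    refine ((hU.valid a (h₂.subset ha)).quorum_history (ρ := certifyRound s.round)
      (by simp [certifyRound, waveLength]) hlt).mono ?_
    rintro v ⟨c, hc, hv, hr⟩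
    exact ⟨c, hU.closed a (h₂.subset ha) c hc, hv, hr, hc⟩
  obtain ⟨c, -, -, hcert, hc⟩ := hU.exists_common hcerts hhist
  exact ⟨⟨h₂.closed a ha b (hcert.isLink.trans hc), hb.2.1.2⟩,
    c, h₂.closed a ha c hc, hcert, hc⟩

theorem Slot.before_trichotomy (s s' : Slot ℓ) : s.Before s' ∨ s = s' ∨ s'.Before s := by
  obtain ⟨r, k⟩ := s
  obtain ⟨r', k'⟩ := s'
  unfold Slot.Before
  rcases lt_trichotomy r r' with h | rfl | h
  · exact .inl (.inl h)
  · rcases lt_trichotomy k k' with h | rfl | h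
    · exact .inl (.inr ⟨rfl, h⟩)
    · exact .inr (.inl rfl)
    · exact .inr (.inr (.inr ⟨rfl, h⟩))
  · exact .inr (.inr (.inl h))

/-- Two views with compatible classifications past round `ρ` have the same anchor. -/
theorem anchor_unique {ρ : ℕ} {s₁ s₂ : Slot ℓ} {a₁ a₂ : Block f Tx} (later₁ : ρ < s₁.round)
    (later₂ : ρ < s₂.round)
    (first₁ : ∀ u : Slot ℓ, ρ < u.round → u.Before s₁ →
      ∀ d, Decides D₂ L u d → Decision.skip = d)
    (anchor₁ : ∀ d, Decides D₂ L s₁ d → Decision.commit a₁ = d)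
    (first₂ : ∀ u : Slot ℓ, ρ < u.round → u.Before s₂ → Decides D₂ L u .skip)
    (anchor₂ : Decides D₂ L s₂ (.commit a₂)) : s₁ = s₂ ∧ a₁ = a₂ := by
  rcases Slot.before_trichotomy s₁ s₂ with h | rfl | h
  · cases anchor₁ _ (first₂ s₁ later₁ h)
  · exact ⟨rfl, by cases anchor₁ _ anchor₂; rfl⟩
  · cases first₁ s₂ later₂ h _ anchor₂

/-- Transfer of certified links between views that contain the end point. -/
theorem IsCertifiedLink.transfer (h₂ : IsView U D₂) {s : Slot ℓ} {a b : Block f Tx} (ha : a ∈ D₂)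
    (hb : b ∈ slotBlocks D₁ L s) (h : IsCertifiedLink D₁ a b) :
    b ∈ slotBlocks D₂ L s ∧ IsCertifiedLink D₂ a b := by
  obtain ⟨c, -, hcert, hc⟩ := h
  exact ⟨⟨h₂.closed a ha b (hcert.isLink.trans hc), hb.2⟩, c, h₂.closed a ha c hc, hcert, hc⟩

/-- Safety: any two views classify a slot in the same way. -/
theorem Decides.unique (hU : NonEquivocating H U) (h₁ : IsView U D₁) (h₂ : IsView U D₂)
    {s : Slot ℓ} {d₁ : Decision f Tx} (h : Decides D₁ L s d₁) :
    ∀ d₂, Decides D₂ L s d₂ → d₁ = d₂ := by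
  induction h with
  | directCommit s b h =>
    rintro (b' | _) h'
    · rw [commit_unique hU h₁ h₂ (.directCommit s b h) h']
    · cases h' with
      | directSkip _ h' => exact (not_commit_of_directSkip hU h₂ h₁ h' (.directCommit s b h)).elim
      | indirectSkip _ s' a _ _ later _ anchor no_link =>
        obtain ⟨ha, -⟩ := anchor.commit_spec
        obtain ⟨hb, hlink⟩ := h.isCertifiedLink hU h₁ h₂ ha.1 (ha.2.2 ▸ later)
        exact (no_link b hb hlink).elim
  | directSkip s h =>
    rintro (b' | _) h'
    · exact (not_commit_of_directSkip hU h₁ h₂ h h').elim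
    · rfl
  | indirectCommit s s' a b coin undecided later first anchor mem link ihf iha =>
    have hb : Decides D₁ L s (.commit b) :=
      .indirectCommit s s' a b coin undecided later first anchor mem link
    rintro (b' | _) h'
    · rw [commit_unique hU h₁ h₂ hb h']
    · cases h' with
      | directSkip _ h' => exact (not_commit_of_directSkip hU h₂ h₁ h' hb).elim
      | indirectSkip _ s'' a' _ _ later' first' anchor' no_link =>
        obtain ⟨rfl, rfl⟩ := anchor_unique later later' ihf iha first' anchor'
        obtain ⟨hb, hlink⟩ := link.transfer h₂ anchor'.commit_spec.1.1 mem
        exact (no_link b hb hlink).elim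
  | indirectSkip s s' a coin undecided later first anchor no_link ihf iha =>
    rintro (b' | _) h'
    · cases h' with
      | directCommit _ _ h' =>
        obtain ⟨ha, -⟩ := anchor.commit_spec
        obtain ⟨hb, hlink⟩ := h'.isCertifiedLink hU h₂ h₁ ha.1 (ha.2.2 ▸ later)
        exact (no_link b' hb hlink).elim
      | indirectCommit _ s'' a' _ _ _ later' first' anchor' mem' link' =>
        obtain ⟨rfl, rfl⟩ := anchor_unique later later' ihf iha first' anchor'
        obtain ⟨hb, hlink⟩ := link'.transfer h₁ anchor.commit_spec.1.1 mem'
        exact (no_link b' hb hlink).elim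
    · rfl

theorem CoinKnown.mono (hD : D₁ ⊆ D₂) {r : ℕ} (h : CoinKnown D₁ r) : CoinKnown D₂ r :=
  Quorum.mono h fun _ ⟨c, hc, hv⟩ => ⟨c, hD hc, hv⟩

theorem DirectCommit.mono (hD : D₁ ⊆ D₂) {s : Slot ℓ} {b : Block f Tx}
    (h : DirectCommit D₁ L s b) : DirectCommit D₂ L s b :=
  ⟨h.1.mono hD, ⟨hD h.2.1.1, h.2.1.2⟩, h.2.2.mono fun _ ⟨c, hc, hv⟩ => ⟨c, hD hc, hv⟩⟩

theorem DirectSkip.mono (h₁ : IsView U D₁) (hD : D₁ ⊆ D₂) {s : Slot ℓ}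
    (h : DirectSkip D₁ L s) : DirectSkip D₂ L s := by
  refine ⟨h.1.mono hD, h.2.1.mono fun _ ⟨c, hc, hv⟩ => ⟨c, hD hc, hv⟩, fun b hb => ?_⟩
  by_cases hb₁ : b ∈ D₁
  · exact (h.2.2 b ⟨hb₁, hb.2⟩).mono fun _ ⟨c, hc, hv⟩ => ⟨c, hD hc, hv⟩
  · refine h.2.1.mono ?_
    rintro v ⟨x, hx, hv, hr⟩
    exact ⟨x, hD hx, hv, hr, fun hvote => hb₁ (h₁.closed x hx b hvote.isLink)⟩

/-- A decision is never revised when the view grows. -/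
theorem Decides.mono (hU : NonEquivocating H U) (h₁ : IsView U D₁) (h₂ : IsView U D₂)
    (hD : D₁ ⊆ D₂) {s : Slot ℓ} {d : Decision f Tx} (h : Decides D₁ L s d) :
    Decides D₂ L s d := by
  have of_direct : ∀ {s : Slot ℓ} {d : Decision f Tx}, Decides D₁ L s d →
      DirectlyDecided D₂ L s → Decides D₂ L s d := by
    rintro s d h (hd | ⟨b, hd⟩)
    · have h' : Decides D₂ L s .skip := .directSkip s hd
      rwa [h.unique hU h₁ h₂ _ h']
    · have h' : Decides D₂ L s (.commit b) := .directCommit s b hd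
      rwa [h.unique hU h₁ h₂ _ h']
  induction h with
  | directCommit s b h => exact .directCommit s b (h.mono hD)
  | directSkip s h => exact .directSkip s (h.mono h₁ hD)
  | indirectCommit s s' a b coin undecided later first anchor mem link ihf iha =>
    by_cases hd : DirectlyDecided D₂ L s
    · exact of_direct
        (.indirectCommit s s' a b coin undecided later first anchor mem link) hd
    · obtain ⟨mem', link'⟩ := link.transfer h₂ (hD anchor.commit_spec.1.1) mem
      exact .indirectCommit s s' a b (coin.mono hD) hd later ihf iha mem' link'
  | indirectSkip s s' a coin undecided later first anchor no_link ihf iha =>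
    by_cases hd : DirectlyDecided D₂ L s
    · exact of_direct (.indirectSkip s s' a coin undecided later first anchor no_link) hd
    · refine .indirectSkip s s' a (coin.mono hD) hd later ihf iha fun b hb hlink => ?_
      obtain ⟨hb', hlink'⟩ := hlink.transfer h₁ anchor.commit_spec.1.1 hb
      exact no_link b hb' hlink'

/-- Delivered blocks stay delivered when the view grows. -/
theorem Delivered.mono (hU : NonEquivocating H U) (h₁ : IsView U D₁) (h₂ : IsView U D₂)
    (hD : D₁ ⊆ D₂) {b : Block f Tx} (h : Delivered D₁ L b) : Delivered D₂ L b := by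
  obtain ⟨s, l, hl, hb, hdec, hfirst⟩ := h
  refine ⟨s, l, hl.mono hU h₁ h₂ hD, hb, fun s' hr hs' => ?_, fun s' hs' l' hl' => ?_⟩
  · obtain ⟨d, hd⟩ := hdec s' hr hs'
    exact ⟨d, hd.mono hU h₁ h₂ hD⟩
  · obtain ⟨hm, -⟩ := hl'.commit_spec
    have hr : 1 ≤ s'.round := hm.2.2 ▸ (hU.valid l' (h₂.subset hm.1)).one_le_round
    obtain ⟨d, hd⟩ := hdec s' hr hs'
    obtain rfl := hd.unique hU h₁ h₂ _ hl'
    exact hfirst s' hs' l' hd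

end Decisions

/-! ## Invariants of the runs -/

section Runs

variable {f : ℕ} {Tx : Type*} {a : ℕ → Action f Tx}

theorem corrupted_mono : Monotone fun t => (configAt a t).corrupted := by
  refine monotone_nat_of_le_succ fun t => ?_
  simp only [configAt, next]
  split
  · exact Finset.subset_insert _ _
  · exact le_rfl

theorem signed_mono : Monotone fun t => (configAt a t).signed := by
  refine monotone_nat_of_le_succ fun t => ?_
  simp only [configAt, next]
  split
  · exact Set.subset_insert _ _
  · exact le_rfl

theorem store_mono (v : Validator f) : Monotone fun t => (configAt a t).store v := by
  refine monotone_nat_of_le_succ fun t x hx => ?_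
  simp only [configAt, next]
  cases a t with
  | propose w b => exact .inl hx
  | receive m => exact .inl hx
  | inject m => exact hx
  | corrupt w => exact hx

theorem dag_mono (v : Validator f) : Monotone fun t => (configAt a t).dag v :=
  fun _ _ h _ hb => ⟨hb.1, fun x hx => store_mono v h (hb.2 x hx)⟩

theorem mem_dag_of_isLink {c : Config f Tx} {v : Validator f} {x b : Block f Tx}
    (hb : b ∈ c.dag v) (h : x.IsLink b) : x ∈ c.dag v :=
  ⟨hb.1.of_isLink h, fun y hy => hb.2 y (hy.trans h)⟩

theorem mem_dag_of_parents {c : Config f Tx} {v : Validator f} {b : Block f Tx} (hv : b.Valid)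
    (hb : b ∈ c.store v) (h : ∀ p ∈ b.parents, p ∈ c.dag v) : b ∈ c.dag v := by
  refine ⟨hv, fun x hx => ?_⟩
  rcases hx.eq_or_exists_parent with rfl | ⟨p, hp, hx⟩
  · exact hb
  · exact (h p hp).2 x hx

theorem store_finite (t : ℕ) (v : Validator f) : ((configAt a t).store v).Finite := by
  induction t with
  | zero => exact Set.finite_empty
  | succ t ih =>
    simp only [configAt, next]
    cases a t with
    | propose w b =>
      refine (ih.union (Set.finite_singleton b)).subset ?_
      rintro x (hx | ⟨-, rfl⟩)
      · exact .inl hx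
      · exact .inr rfl
    | receive m =>
      have hm : {x | m.content = .block x}.Finite := by
        refine Set.Subsingleton.finite fun x hx y hy => ?_
        simpa using Eq.trans (Eq.symm hx) hy
      refine (ih.union hm).subset ?_
      rintro x (hx | ⟨-, -, hx⟩)
      · exact .inl hx
      · exact .inr hx
    | inject m => exact ih
    | corrupt w => exact ih

theorem dag_finite (t : ℕ) (v : Validator f) : ((configAt a t).dag v).Finite :=
  (store_finite t v).subset fun b hb => hb.2 b .refl

/-- Signatures are not forged, and uncorrupted validators do not equivocate. -/
structure Authentic (c : Config f Tx) : Prop where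
  store : ∀ v, ∀ b ∈ c.store v, b.author ∈ c.corrupted ∨ b ∈ c.signed
  sent : ∀ m ∈ c.sent, ∀ b, m.content = .block b → b.author ∈ c.corrupted ∨ b ∈ c.signed
  round_le : ∀ b ∈ c.signed, b.round ≤ c.round b.author
  unique : ∀ x ∈ c.signed, ∀ y ∈ c.signed, x.author = y.author → x.round = y.round → x = y

theorem Authentic.next {c : Config f Tx} (h : Authentic c) {act : Action f Tx}
    (he : Enabled c act) : Authentic (next c act) := by
  cases act with
  | propose v b =>
    obtain ⟨-, hauth, hround, -⟩ := he
    have weaken : ∀ x : Block f Tx, x.author ∈ c.corrupted ∨ x ∈ c.signed →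
        x.author ∈ c.corrupted ∨ x ∈ insert b c.signed := fun x hx => hx.imp_right (.inr ·)
    refine ⟨?_, ?_, ?_, ?_⟩
    · rintro u x (hx | ⟨-, rfl⟩)
      · exact weaken x (h.store u x hx)
      · exact .inr (.inl rfl)
    · rintro m (hm | ⟨-, hm⟩) x hx
      · exact weaken x (h.sent m hm x hx)
      · rw [hm] at hx
        cases hx
        exact .inr (.inl rfl)
    · rintro x (rfl | hx)
      · simp [MahiMahi.next, hauth]
      · have := h.round_le x hx
        simp only [MahiMahi.next, Function.update_apply]
        split
        · next hxv => rw [hxv] at this; omega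
        · exact this
    · have old : ∀ x ∈ c.signed, x.author = b.author → x.round ≠ b.round := by
        intro x hx hxb hr
        have := h.round_le x hx
        rw [hxb, hauth] at this
        omega
      rintro x (rfl | hx) y (rfl | hy) hxy hr
      · rfl
      · exact (old y hy hxy.symm hr.symm).elim
      · exact (old x hx hxy hr).elim
      · exact h.unique x hx y hy hxy hr
  | receive m =>
    refine ⟨?_, ?_, h.round_le, h.unique⟩
    · rintro u x (hx | ⟨-, -, hx⟩)
      · exact h.store u x hx
      · exact h.sent m he x hx
    · rintro m' (hm | ⟨-, -, -, (⟨_, p, -, -, -, hm⟩ | ⟨y, -, hy, hm⟩)⟩) x hx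
      · exact h.sent m' hm x hx
      · rw [hm] at hx
        cases hx
      · rw [hm] at hx
        cases hx
        exact h.store m.dst _ hy
  | inject m =>
    refine ⟨h.store, ?_, h.round_le, h.unique⟩
    rintro m' (hm | hm) x hx
    · exact h.sent m' hm x hx
    · obtain rfl : m' = m := hm
      exact he.2 x hx
  | corrupt v =>
    have weaken : ∀ x : Block f Tx, x.author ∈ c.corrupted ∨ x ∈ c.signed →
        x.author ∈ insert v c.corrupted ∨ x ∈ c.signed :=
      fun x hx => hx.imp_left Finset.mem_insert_of_mem
    refine ⟨fun u x hx => weaken x (h.store u x hx), ?_, h.round_le, h.unique⟩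
    rintro m (hm | hm) x hx
    · exact weaken x (h.sent m hm x hx)
    · exact hm.elim

theorem IsRun.authentic (ha : IsRun a) (t : ℕ) : Authentic (configAt a t) := by
  induction t with
  | zero => constructor <;> simp [configAt, Config.initial]
  | succ t ih => exact ih.next (ha.enabled t)

theorem IsRun.card_corrupted_le (ha : IsRun a) (t : ℕ) : (configAt a t).corrupted.card ≤ f := by
  induction t with
  | zero => simp [configAt, Config.initial]
  | succ t ih =>
    have he := ha.enabled t
    simp only [configAt, next]
    split
    · next v hv =>
      rw [hv] at he
      exact he
    · exact ih

/-- At least `2 f + 1` validators are honest. -/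
theorem IsRun.quorum_honest (ha : IsRun a) : Quorum {v | Honest a v} := by
  have hex : ∀ v : Validator f, ∃ t, ¬ Honest a v → v ∈ (configAt a t).corrupted := by
    intro v
    by_cases hv : Honest a v
    · exact ⟨0, fun h => (h hv).elim⟩
    · unfold Honest at hv
      push Not at hv
      exact hv.imp fun t ht _ => ht
  choose τ hτ using hex
  obtain ⟨T, hT⟩ := (Set.finite_range τ).bddAbove
  have hsub : {v | Honest a v}ᶜ ⊆ ((configAt a T).corrupted : Set (Validator f)) :=
    fun v hv => corrupted_mono (hT ⟨v, rfl⟩) (hτ v hv)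
  have h₁ := Set.ncard_le_ncard hsub (Set.toFinite _)
  rw [Set.ncard_coe_finset] at h₁
  have h₂ := ha.card_corrupted_le T
  have h₃ := Set.ncard_add_ncard_compl {v | Honest a v}
  simp only [Nat.card_eq_fintype_card, Fintype.card_fin] at h₃
  unfold Quorum
  omega

/-- The blocks that are ever in the local DAG of an honest validator. -/
def honestBlocks (a : ℕ → Action f Tx) : Set (Block f Tx) :=
  {b | ∃ t v, Honest a v ∧ b ∈ (configAt a t).dag v}

theorem IsRun.nonEquivocating (ha : IsRun a) :
    NonEquivocating {v | Honest a v} (honestBlocks a) where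
  quorum := ha.quorum_honest
  valid := fun _ ⟨_, _, _, hb⟩ => hb.1
  closed := fun _ ⟨t, v, hv, hb⟩ _ hx => ⟨t, v, hv, mem_dag_of_isLink hb hx⟩
  unique := by
    have signed_of_mem : ∀ x ∈ honestBlocks a, Honest a x.author →
        ∃ t, x ∈ (configAt a t).signed := by
      rintro x ⟨t, v, -, hx⟩ hauth
      exact ⟨t, ((ha.authentic t).store v x (hx.2 x .refl)).resolve_left (hauth t)⟩
    intro x hx y hy hauth hxy hr
    obtain ⟨t, ht⟩ := signed_of_mem x hx hauth
    obtain ⟨t', ht'⟩ := signed_of_mem y hy (hxy ▸ hauth)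
    exact (ha.authentic (max t t')).unique x (signed_mono (le_max_left t t') ht) y
      (signed_mono (le_max_right t t') ht') hxy hr

theorem isView_dag {v : Validator f} (hv : Honest a v) (t : ℕ) :
    IsView (honestBlocks a) ((configAt a t).dag v) where
  subset := fun _ hb => ⟨t, v, hv, hb⟩
  closed := fun _ hb _ hx => mem_dag_of_isLink hb hx

/-! ## Dissemination of blocks -/

/-- If each of finitely many blocks is eventually in the local DAG, then there is a time from which
on they all are. -/
theorem exists_subset_dag {v : Validator f} {S : Set (Block f Tx)} (hS : S.Finite)
    (h : ∀ x ∈ S, ∃ t, x ∈ (configAt a t).dag v) : ∃ t, S ⊆ (configAt a t).dag v := by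
  induction S, hS using Set.Finite.induction_on with
  | empty => exact ⟨0, Set.empty_subset _⟩
  | @insert x S _ _ ih =>
    obtain ⟨t, ht⟩ := ih fun y hy => h y (.inr hy)
    obtain ⟨t', ht'⟩ := h x (.inl rfl)
    refine ⟨max t t', Set.insert_subset (dag_mono v (le_max_right t t') ht') ?_⟩
    exact ht.trans (dag_mono v (le_max_left t t'))

/-- A block that an honest validator receives from an honest validator with its causal history is
eventually in the local DAG of the receiver. -/
theorem IsRun.exists_mem_dag_of_receive (ha : IsRun a) {i j : Validator f} (hi : Honest a i)
    (hj : Honest a j) {b : Block f Tx} (hv : b.Valid) :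
    ∀ t, a t = .receive ⟨i, j, .block b⟩ → b ∈ (configAt a t).dag i →
      ∃ t', b ∈ (configAt a t').dag j := by
  induction hv with
  | intro b h₁ h₂ h₃ h₄ h₅ ih =>
    intro t hrec hb
    have hparents : ∀ p ∈ b.parents, ∃ t', p ∈ (configAt a t').dag j := by
      intro p hp
      by_cases hpj : p ∈ (configAt a t).dag j
      · exact ⟨t, hpj⟩
      obtain ⟨t₁, ht₁, hreq⟩ := ha.reliable t ⟨j, i, .request p⟩
        (by rw [hrec]; exact ⟨hj t, rfl, rfl, .inl ⟨b, p, rfl, hp, hpj, rfl⟩⟩) hj hi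
      have hpi : p ∈ (configAt a t).dag i := mem_dag_of_isLink hb (.of_mem_parents hp)
      have hpi₁ := dag_mono i ht₁.le hpi
      obtain ⟨t₂, ht₂, hans⟩ := ha.reliable t₁ ⟨i, j, .block p⟩
        (by rw [hreq]; exact ⟨hi t₁, rfl, rfl, .inr ⟨p, rfl, hpi₁.2 p .refl, rfl⟩⟩) hi hj
      exact ih p hp t₂ hans (dag_mono i ht₂.le hpi₁)
    obtain ⟨t', ht'⟩ := exists_subset_dag (S := {p | p ∈ b.parents})
      (List.finite_toSet b.parents) hparents
    have hstore : b ∈ (configAt a (t + 1)).store j := by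
      simp [configAt, next, hrec, hj t]
    refine ⟨max (t + 1) t', mem_dag_of_parents hb.1 (store_mono j (le_max_left _ _) hstore) ?_⟩
    exact fun p hp => dag_mono j (le_max_right _ _) (ht' hp)

theorem IsRun.mem_dag_of_propose (ha : IsRun a) {t : ℕ} {v : Validator f} {b : Block f Tx}
    (h : a t = .propose v b) : b ∈ (configAt a (t + 1)).dag v := by
  have he := ha.enabled t
  rw [h] at he
  obtain ⟨-, -, -, hv, hparents, -⟩ := he
  refine mem_dag_of_parents hv ?_ fun p hp => dag_mono v t.le_succ (hparents p hp)
  simp [configAt, next, h]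

/-- A block created by an honest validator is eventually in every honest local DAG. -/
theorem IsRun.exists_mem_dag_of_propose (ha : IsRun a) {i j : Validator f} (hi : Honest a i)
    (hj : Honest a j) {t : ℕ} {b : Block f Tx} (h : a t = .propose i b) :
    ∃ t', b ∈ (configAt a t').dag j := by
  have hb := ha.mem_dag_of_propose h
  obtain ⟨t', ht', hrec⟩ := ha.reliable t ⟨i, j, .block b⟩ (by rw [h]; exact ⟨rfl, rfl⟩) hi hj
  exact ha.exists_mem_dag_of_receive hi hj hb.1 t' hrec (dag_mono i ht' hb)

theorem IsRun.round_mono (ha : IsRun a) (v : Validator f) :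
    Monotone fun t => (configAt a t).round v := by
  refine monotone_nat_of_le_succ fun t => ?_
  have he := ha.enabled t
  simp only [configAt, next]
  cases hact : a t with
  | propose w b =>
    rw [hact] at he
    obtain ⟨-, -, hround, -⟩ := he
    simp only [Function.update_apply]
    split
    · next hvw => rw [hvw]; omega
    · exact le_rfl
  | receive m => exact le_rfl
  | inject m => exact le_rfl
  | corrupt w => exact le_rfl

/-- A validator that passes from a round below `r` to round `r` or beyond creates a block of round
`r` in between. -/
theorem IsRun.exists_propose_of_lt_of_le (ha : IsRun a) {v : Validator f} {r t T : ℕ}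
    (hlt : (configAt a t).round v < r) (hle : r ≤ (configAt a T).round v) :
    ∃ t' ≥ t, ∃ b, a t' = .propose v b ∧ b.round = r := by
  induction T with
  | zero =>
    have := ha.round_mono v (Nat.zero_le t)
    dsimp only at this
    omega
  | succ T ih =>
    rcases Nat.lt_or_ge ((configAt a T).round v) r with hT | hT
    · have htT : t ≤ T := by
        by_contra hcon
        have := ha.round_mono v (show T + 1 ≤ t by omega)
        dsimp only at this
        omega
      have he := ha.enabled T
      simp only [configAt, next] at hle
      cases hact : a T with
      | propose w b =>
        rw [hact] at he hle
        obtain ⟨-, -, hround, -⟩ := he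
        simp only [Function.update_apply] at hle
        split at hle
        · next hvw =>
          subst hvw
          exact ⟨T, htT, b, hact, by omega⟩
        · omega
      | receive m => rw [hact] at hle; dsimp only at hle; omega
      | inject m => rw [hact] at hle; dsimp only at hle; omega
      | corrupt w => rw [hact] at hle; dsimp only at hle; omega
    · exact ih hT

/-- Every honest validator passes through all rounds. -/
theorem IsRun.exists_le_round (ha : IsRun a) (r : ℕ) :
    ∀ v, Honest a v → ∃ t, r ≤ (configAt a t).round v := by
  induction r with
  | zero => exact fun v _ => ⟨0, Nat.zero_le _⟩
  | succ r ih =>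
    intro v hv
    have hready : ∃ t, r < (configAt a t).round v ∨
        r ≤ (configAt a t).round v ∧ Ready (configAt a t) v := by
      rcases Nat.eq_zero_or_pos r with rfl | hr
      · exact ⟨0, .inr ⟨Nat.zero_le _, .inl rfl⟩⟩
      have hblocks : ∀ u : Validator f, ∃ t, Honest a u →
          ∃ x ∈ (configAt a t).dag v, x.author = u ∧ x.round = r := by
        intro u
        by_cases hu : Honest a u
        · obtain ⟨T, hT⟩ := ih u hu
          obtain ⟨t, -, b, hb, hbr⟩ := ha.exists_propose_of_lt_of_le (t := 0) hr hT
          obtain ⟨t', ht'⟩ := ha.exists_mem_dag_of_propose hu hv hb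
          have he := ha.enabled t
          rw [hb] at he
          exact ⟨t', fun _ => ⟨b, ht', he.2.1, hbr⟩⟩
        · exact ⟨0, fun h => (hu h).elim⟩
      choose τ hτ using hblocks
      obtain ⟨T, hT⟩ := (Set.finite_range τ).bddAbove
      obtain ⟨T', hT'⟩ := ih v hv
      refine ⟨max T T', ?_⟩
      have hle : r ≤ (configAt a (max T T')).round v :=
        hT'.trans (ha.round_mono v (le_max_right T T'))
      rcases hle.lt_or_eq with hlt | heq
      · exact .inl hlt
      · refine .inr ⟨hle, .inr (ha.quorum_honest.mono fun u hu => ?_)⟩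
        obtain ⟨x, hx, hxu, hxr⟩ := hτ u hu
        exact ⟨x, dag_mono v ((hT ⟨u, rfl⟩).trans (le_max_left T T')) hx, hxu, hxr.trans heq⟩
    obtain ⟨t, ht | ⟨hle, ht⟩⟩ := hready
    · exact ⟨t, ht⟩
    · obtain ⟨t', ht', b, hb⟩ := ha.progress v hv t ht
      have he := ha.enabled t'
      rw [hb] at he
      have hmono := ha.round_mono v ht'
      refine ⟨t' + 1, ?_⟩
      simp only [configAt, next, hb, Function.update_self, he.2.2.1]
      dsimp only at hmono
      omega

/-- A block in the local DAG of an honest validator is eventually in every honest local DAG. -/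
theorem IsRun.exists_mem_dag (ha : IsRun a) {i j : Validator f} (hi : Honest a i)
    (hj : Honest a j) {t : ℕ} {b : Block f Tx} (hb : b ∈ (configAt a t).dag i) :
    ∃ t', b ∈ (configAt a t').dag j := by
  set r := max b.round ((configAt a t).round i) + 1 with hr
  obtain ⟨T, hT⟩ := ha.exists_le_round r i hi
  obtain ⟨t', ht', B, hB, hBr⟩ := ha.exists_propose_of_lt_of_le (t := t) (by omega) hT
  have he := ha.enabled t'
  rw [hB] at he
  have hlink : b.IsLink B := he.2.2.2.2.2 b (dag_mono i ht' hb) (by omega)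
  obtain ⟨t₁, ht₁⟩ := ha.exists_mem_dag_of_propose hi hj hB
  exact ⟨t₁, mem_dag_of_isLink ht₁ hlink⟩

/-- Agreement holds in every run, whatever the outcomes of the coin. -/
theorem IsRun.agreement (ha : IsRun a) {ℓ : ℕ} (L : Leaders f ℓ) {i j : Validator f}
    (hi : Honest a i) (hj : Honest a j) {b : Block f Tx} {t : ℕ}
    (h : Delivered ((configAt a t).dag i) L b) :
    ∃ t', Delivered ((configAt a t').dag j) L b := by
  obtain ⟨t', ht'⟩ := exists_subset_dag (v := j) (dag_finite t i)
    fun x hx => ha.exists_mem_dag hi hj hx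
  exact ⟨t', h.mono ha.nonEquivocating (isView_dag hi t) (isView_dag hj t') ht'⟩

end Runs

theorem Execution.IsAsynchronous.agreement {f ℓ : ℕ} {Tx Ω : Type*} [MeasurableSpace Ω]
    {μ : Measure Ω} {X : Execution f ℓ Tx Ω} (h : X.IsAsynchronous μ) : X.Agreement μ := by
  filter_upwards [h.run] with ω hω i j hi hj b ⟨_, hb⟩
  exact hω.agreement _ hi hj hb

end MahiMahi

/-- Agreement of the protocol with waves of four rounds, in the asynchronous and in the random network
model. -/
theorem mainTheorem6 (f ℓ : ℕ) (hℓ : 1 ≤ ℓ) (hℓn : ℓ ≤ 3 * f + 1)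
    {Tx : Type*} [Countable Tx] {Ω : Type*} [MeasurableSpace Ω]
    (μ : MeasureTheory.Measure Ω) [MeasureTheory.IsProbabilityMeasure μ]
    (X : MahiMahi.Execution f ℓ Tx Ω) :
    (X.IsAsynchronous μ → X.Agreement μ) ∧ (X.IsRandomNetwork μ → X.Agreement μ) :=
  ⟨fun h => h.agreement, fun h => h.toIsAsynchronous.agreement⟩
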